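/- **Setting.** Let $\mathbf M$ be a compact metric space with distance $\rho$ and let a group $G$ act on $\mathbf M$ so that, for all $x,y,x',y'\in\mathbf M$, $\rho(x,y)=\rho(x',y')$ if and only if $gx=x'$, $gy=y'$ for some $g\in G$ ($\mathbf M$ is a compact 2-point-homogeneous space). Let $\mu$ be the $G$-invariant Borel probability measure on $\mathbf M$. Let $\tau(x,y)=F(\rho(x,y))$ for a function $F:\mathbb R\to\mathbb R$, and put $\tau_0=\tau(x,x)=F(0)$, $T=\{\tau(x,y):x,y\in\mathbf M\}$. Let $\Phi_k$, $0\le k<K$ ($K\le\infty$; $K$ is finite exactly when $\mathbf M$ is finite), be the zonal spherical functions of $\mathbf M$, and assume that $\Phi_k(t)=\sum_{\ell=0}^k p_{k\ell}t^\ell$ is a polynomial of degree $k$. That is, there are finite-dimensional, pairwise $L^2(\mu)$-orthogonal, irreducible $G$-invariant spaces $V_k$ ($k<K$) of continuous real functions on $\mathbf M$ whose sum is dense in $C(\mathbf M)$, and $\Phi_k(\tau(x,y))$ is the multiple of the reproducing kernel of $V_k\subset L^2(\mu)$ normalized by $\Phi_k(\tau_0)=1$. Let $a,b$ be real and $S=T\cap[a,b]$.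 A finite set $C\subset\mathbf M$ is an $S$-code if $\tau(x,y)\in S$ for all distinct $x,y\in C$; for $\mathbf\Pi\subseteq\mathbf M$ let $A(\mathbf\Pi,S)$ be the largest cardinality (the supremum of the cardinalities) of the $S$-codes contained in $\mathbf\Pi$. Let $q_1,\dots,q_r\in\mathbf M$ (the set $C_0$), and let $\Pi_1,\dots,\Pi_d\subseteq\mathbf M$ be pairwise disjoint with $\mathbf\Pi\subseteq\Pi_1\cup\dots\cup\Pi_d$. Let $\alpha_{ij},\beta_{ij}\in[-\infty,\infty]$ be such that $\alpha_{ij}\le\tau(q_i,v)\le\beta_{ij}$ for all $v\in\Pi_j$, $1\le i\le r$, $1\le j\le d$, and let $a_{ij},b_{ij}\in\mathbb R$ ($i\le j$) be such that for all $u\in\Pi_i$, $v\in\Pi_j$, $u\ne v$, if $\tau(u,v)\in[a,b]$ then $\tau(u,v)\in[a_{ij},b_{ij}]$. For an integer $m\ge1$ and numbers $s_0,\dots,s_{2m-1}$ let $H_m(s_0,\dots,s_{2m-1},[\alpha,\beta])$ be the block diagonal matrix with the three $m\times m$ blocks $$(s_{i+j})_{0\le i,j<m},\qquad (s_{i+j+1}-\alpha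 s_{i+j})_{0\le i,j<m},\qquad (\beta s_{i+j}-s_{i+j+1})_{0\le i,j<m},$$ where the block of an infinite endpoint is omitted. **The problem $\widehat{SDP}$.** Fix $m\ge1$. The variables are real numbers $c_j$, $x^{(k)}_{ij}=x^{(k)}_{ji}$ $(1\le i,j\le d)$ and $y^{(k)}_{ij}$ $(1\le i\le r,\ 1\le j\le d)$, for $0\le k\le 2m-1$. Let $Ad(c,\mathbf x,\mathbf y)$ be a square real matrix whose entries are affine functions of the variables (possibly of size $0$), such that $Ad\succeq0$ holds at the values $$c_j=|C_j|,\qquad x^{(k)}_{ij}=\sum_{u\in C_i}\sum_{v\in C_j}\tau(u,v)^k,\qquad y^{(k)}_{ij}=\sum_{v\in C_j}\tau(q_i,v)^k,\qquad C_j=C\cap\Pi_j,$$ of every $S$-code $C\subset\mathbf\Pi$. Here and below $0^0=1$, and $X\succeq0$ means that $X$ is symmetric and positive semidefinite. The problem is to maximize $c=c_1+\dots+c_d$ subject to: 1. $\Gamma_k(\mathbf x,\mathbf y)\succeq0$ for all $0\le k\le 2m-1$ with $k<K$, where $$\Gamma_k=\begin{pmatrix}\bigl(\Phi_k(\tau(q_i,q_j))\bigr)_{i,j\le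 r}&\bigl(\sum_\ell p_{k\ell}\,y^{(\ell)}_{ij}\bigr)_{i\le r,\,j\le d}\\ \bigl(\sum_\ell p_{k\ell}\,y^{(\ell)}_{ji}\bigr)_{i\le d,\,j\le r}&\bigl(\sum_\ell p_{k\ell}\,x^{(\ell)}_{ij}\bigr)_{i,j\le d}\end{pmatrix};$$ 2. $H_m(y^{(0)}_{ij},\dots,y^{(2m-1)}_{ij},[\alpha_{ij},\beta_{ij}])\succeq0$ for $1\le i\le r$, $1\le j\le d$; 3. $H_m(x^{(0)}_{ij},\dots,x^{(2m-1)}_{ij},[a_{ij},b_{ij}])\succeq0$ for $1\le i<j\le d$; 4. $H_m(z_{0,i},\dots,z_{2m-1,i},[a_{ii},b_{ii}])\succeq0$ for $1\le i\le d$, where $z_{k,i}=x^{(k)}_{ii}-c_i\tau_0^k$; 5. $Ad(c,\mathbf x,\mathbf y)\succeq0$; 6. $y^{(0)}_{ij}=c_j$ for all $i,j$, $c_j\ge0$ for all $j$, and $$\begin{pmatrix}1&c_1&\cdots&c_d\\ c_1&x^{(0)}_{11}&\cdots&x^{(0)}_{1d}\\ \vdots&\vdots&\ddots&\vdots\\ c_d&x^{(0)}_{1d}&\cdots&x^{(0)}_{dd}\end{pmatrix}\succeq0.$$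 Let $c^*(m,C_0,d,\{\Pi_i\},Ad)\in[-\infty,\infty]$ be the maximal value (the supremum) of $c$ over all feasible points. **Theorem.** $\displaystyle A(\mathbf\Pi,S)\le c^*(m,C_0,d,\{\Pi_i\},Ad).$ -/

import Mathlib

open MeasureTheory Polynomial
open scoped ENNReal

namespace CodeSDP

/-! ### Two-point-homogeneous spaces and zonal spherical functions -/

/-- The metric of `M` is strongly invariant under the action of `G`: two pairs of points are at the
same distance if and only if some element of `G` takes one pair to the other. -/
def IsTwoPointHomogeneous (G M : Type*) [Group G] [MetricSpace M] [MulAction G M] : Prop :=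
  ∀ x y x' y' : M, dist x y = dist x' y' ↔ ∃ g : G, g • x = x' ∧ g • y = y'

/-- A space of continuous functions on `M` that is stable under all translations `f ↦ f (g • ·)`. -/
def IsInvariantSubspace (G : Type*) {M : Type*} [Group G] [MetricSpace M] [MulAction G M]
    (V : Submodule ℝ C(M, ℝ)) : Prop :=
  ∀ g : G, ∀ f ∈ V, ∃ h ∈ V, ∀ x, h x = f (g • x)

/-- `V` is an irreducible `G`-module: nonzero, invariant, without proper nonzero invariant
subspaces. -/
structure IsIrreducibleSubspace (G : Type*) {M : Type*} [Group G] [MetricSpace M] [MulAction G M]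
    (V : Submodule ℝ C(M, ℝ)) : Prop where
  ne_bot : V ≠ ⊥
  invariant : IsInvariantSubspace G V
  eq_bot_or_eq : ∀ W : Submodule ℝ C(M, ℝ), W ≤ V → IsInvariantSubspace G W → W = ⊥ ∨ W = V

/-- `τ(x, y) = F(ρ(x, y))`, where `ρ` is the distance of `M`. -/
def tau {M : Type*} [MetricSpace M] (F : ℝ → ℝ) (x y : M) : ℝ := F (dist x y)

/-- `φ` is the zonal spherical function of the finite-dimensional space `V` of continuous functions:
`(x, y) ↦ φ(τ(x, y))` is the multiple of the reproducing kernel of `V ⊆ L²(μ)` that is equal to `1`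
on the diagonal. (The multiple is then `1 / dim V`.) -/
structure IsZonalSpherical {M : Type*} [MetricSpace M] [MeasurableSpace M] (μ : Measure M)
    (F : ℝ → ℝ) (V : Submodule ℝ C(M, ℝ)) (φ : ℝ[X]) : Prop where
  finiteDimensional : FiniteDimensional ℝ V
  mem : ∀ y : M, ∃ z ∈ V, ∀ x : M, z x = φ.eval (tau F x y)
  reproducing : ∃ κ : ℝ, ∀ f ∈ V, ∀ y : M, f y = κ * ∫ x, f x * φ.eval (tau F x y) ∂μ
  normalized : φ.eval (F 0) = 1

/-- `Φ_k`, `k < K` (where `K ≤ ∞`), are the zonal spherical functions of `M`, and `Φ_k` is a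
polynomial of degree `k` in `τ`. That is, the functions on `M` decompose into pairwise orthogonal
irreducible `G`-modules `V_k`, `k < K`, whose zonal spherical functions are the `Φ_k`.
The number `K` of the modules is infinite for the infinite spaces and finite for the finite ones. -/
def IsZonalFamily (G : Type*) {M : Type*} [Group G] [MetricSpace M] [MulAction G M]
    [MeasurableSpace M] [CompactSpace M] (μ : Measure M) (F : ℝ → ℝ) (K : ℕ∞) (Φ : ℕ → ℝ[X]) :
    Prop :=
  ∃ V : ℕ → Submodule ℝ C(M, ℝ),
    (∀ k : ℕ, (k : ℕ∞) < K → IsIrreducibleSubspace G (V k)) ∧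
    (∀ j k : ℕ, (j : ℕ∞) < K → (k : ℕ∞) < K → j ≠ k →
      ∀ f ∈ V j, ∀ h ∈ V k, ∫ x, f x * h x ∂μ = 0) ∧
    (⨆ (k : ℕ) (_ : (k : ℕ∞) < K), V k).topologicalClosure = ⊤ ∧
    (∀ k : ℕ, (k : ℕ∞) < K → IsZonalSpherical μ F (V k) (Φ k)) ∧
    (∀ k : ℕ, (k : ℕ∞) < K → (Φ k).natDegree = k)

/-! ### Codes -/

/-- `T`, the set of all values of `τ`. -/
def tauValues (M : Type*) [MetricSpace M] (F : ℝ → ℝ) : Set ℝ := {t | ∃ x y : M, tau F x y = t}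

/-- A finite set `C` is an `S`-code if `τ(x, y) ∈ S` for all distinct `x, y ∈ C`. -/
def IsCode {M : Type*} [MetricSpace M] (F : ℝ → ℝ) (S : Set ℝ) (C : Finset M) : Prop :=
  ∀ x ∈ C, ∀ y ∈ C, x ≠ y → tau F x y ∈ S

/-- `A(Π, S)`, the largest cardinality of an `S`-code contained in `Π`. -/
noncomputable def maxCode {M : Type*} [MetricSpace M] (F : ℝ → ℝ) (S : Set ℝ) (P : Set M) : ℕ∞ :=
  ⨆ (C : Finset M) (_ : (C : Set M) ⊆ P ∧ IsCode F S C), (C.card : ℕ∞)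

/-! ### The matrices `H_m` -/

/-- `R_m = (s_{i+j})`, with rows and columns numbered from `0`. -/
def hankelR (m : ℕ) (s : Fin (2 * m) → ℝ) : Matrix (Fin m) (Fin m) ℝ :=
  Matrix.of fun i j => s ⟨i + j, by omega⟩

/-- `F_m^+(a) = (s_{i+j+1} - a s_{i+j})`; for infinite `a` there is no such condition, and the block
is `0`. -/
noncomputable def hankelPlus (m : ℕ) (s : Fin (2 * m) → ℝ) (a : EReal) :
    Matrix (Fin m) (Fin m) ℝ := by
  classical
  exact if a = ⊥ ∨ a = ⊤ then 0 else
    Matrix.of fun i j => s ⟨i + j + 1, by omega⟩ - a.toReal * s ⟨i + j, by omega⟩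

/-- `F_m^-(b) = (b s_{i+j} - s_{i+j+1})`; for infinite `b` there is no such condition, and the block
is `0`. -/
noncomputable def hankelMinus (m : ℕ) (s : Fin (2 * m) → ℝ) (b : EReal) :
    Matrix (Fin m) (Fin m) ℝ := by
  classical
  exact if b = ⊥ ∨ b = ⊤ then 0 else
    Matrix.of fun i j => b.toReal * s ⟨i + j, by omega⟩ - s ⟨i + j + 1, by omega⟩

/-- `H_m(s_0, …, s_{2m-1}, [a, b])`, the block diagonal matrix of `R_m`, `F_m^+(a)`, `F_m^-(b)`. -/
noncomputable def hankelH (m : ℕ) (s : Fin (2 * m) → ℝ) (a b : EReal) :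
    Matrix (Fin m ⊕ (Fin m ⊕ Fin m)) (Fin m ⊕ (Fin m ⊕ Fin m)) ℝ :=
  Matrix.fromBlocks (hankelR m s) 0 0
    (Matrix.fromBlocks (hankelPlus m s a) 0 0 (hankelMinus m s b))

/-! ### The semidefinite program -/

/-- The variables `c_j`, `x_{ij}^{(k)}` and `y_{ij}^{(k)}`, `0 ≤ k ≤ 2m - 1`, as a triple
`(c, x, y)`. The number `x_{ij}^{(k)}` is `x k i j`. -/
abbrev Vars (m r d : ℕ) : Type :=
  (Fin d → ℝ) × (Fin (2 * m) → Fin d → Fin d → ℝ) × (Fin (2 * m) → Fin r → Fin d → ℝ)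

/-- The values of the variables that come from a finite set `C`: with `C_j = C ∩ Π_j`,
`c_j = |C_j|`, `x_{ij}^{(k)} = ∑_{u ∈ C_i, v ∈ C_j} τ(u,v)^k`,
`y_{ij}^{(k)} = ∑_{v ∈ C_j} τ(q_i,v)^k`. -/
noncomputable def codeVars {M : Type*} [MetricSpace M] (F : ℝ → ℝ) (m : ℕ) {r d : ℕ}
    (q : Fin r → M) (P : Fin d → Set M) (C : Finset M) : Vars m r d := by
  classical
  exact
    (fun j => ((C.filter fun v => v ∈ P j).card : ℝ),
     fun k i j => ∑ u ∈ C.filter (fun u => u ∈ P i), ∑ v ∈ C.filter (fun v => v ∈ P j),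
       tau F u v ^ (k : ℕ),
     fun k i j => ∑ v ∈ C.filter (fun v => v ∈ P j), tau F (q i) v ^ (k : ℕ))

/-- `Γ_k(x, y)`, where `φ = Φ_k = ∑ p_{kℓ} t^ℓ`: the entries are `Φ_k(τ(q_i, q_j))`,
`∑_ℓ p_{kℓ} y_{ij}^{(ℓ)}` and `∑_ℓ p_{kℓ} x_{ij}^{(ℓ)}`. -/
noncomputable def gammaMatrix {M : Type*} [MetricSpace M] (F : ℝ → ℝ) {m r d : ℕ}
    (φ : ℝ[X]) (q : Fin r → M) (v : Vars m r d) : Matrix (Fin r ⊕ Fin d) (Fin r ⊕ Fin d) ℝ :=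
  Matrix.fromBlocks
    (Matrix.of fun i j => φ.eval (tau F (q i) (q j)))
    (Matrix.of fun i j => ∑ l : Fin (2 * m), φ.coeff l * v.2.2 l i j)
    (Matrix.of fun j i => ∑ l : Fin (2 * m), φ.coeff l * v.2.2 l i j)
    (Matrix.of fun i j => ∑ l : Fin (2 * m), φ.coeff l * v.2.1 l i j)

/-- The matrix with the corner `1`, the border `c_1, …, c_d` and the entries `h_{ij}`. -/
def borderedMatrix {d : ℕ} (c : Fin d → ℝ) (h : Fin d → Fin d → ℝ) :
    Matrix (Unit ⊕ Fin d) (Unit ⊕ Fin d) ℝ :=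
  Matrix.fromBlocks (Matrix.of fun _ _ => 1) (Matrix.of fun _ j => c j)
    (Matrix.of fun i _ => c i) (Matrix.of h)

/-- The data of the program: `τ = F(ρ)`; `Φ_k`, `k < K`; `m > 0`; the points `q_i`; the bounds
`[α_{ij}, β_{ij}]` (possibly infinite) on `τ(q_i, ·)` in `Π_j`; the bounds `[a_{ij}, b_{ij}]` on `τ`
between `Π_i` and `Π_j`; and the additional constraints, a linear matrix inequality
`Ad(c, x, y) ⪰ 0` of some size `N` (`N = 0` if there are none). -/
structure Program (M : Type*) (r d : ℕ) where
  F : ℝ → ℝ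
  K : ℕ∞
  Φ : ℕ → ℝ[X]
  m : ℕ
  m_pos : 0 < m
  q : Fin r → M
  α : Fin r → Fin d → EReal
  β : Fin r → Fin d → EReal
  a : Fin d → Fin d → ℝ
  b : Fin d → Fin d → ℝ
  N : ℕ
  Ad : Vars m r d →ᵃ[ℝ] Matrix (Fin N) (Fin N) ℝ

namespace Program

variable {M : Type*} {r d : ℕ}

/-- The index `k = 0` of the moments. -/
def zeroIdx (D : Program M r d) : Fin (2 * D.m) := ⟨0, Nat.mul_pos Nat.two_pos D.m_pos⟩

/-- The constraints of the program. -/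
structure Feasible [MetricSpace M] (D : Program M r d) (v : Vars D.m r d) : Prop where
  x_symm : ∀ k i j, v.2.1 k i j = v.2.1 k j i
  gamma : ∀ k : Fin (2 * D.m), ((k : ℕ) : ℕ∞) < D.K →
    (gammaMatrix D.F (D.Φ k) D.q v).PosSemidef
  hankel_y : ∀ i j,
    (hankelH D.m (fun k => v.2.2 k i j) (D.α i j) (D.β i j)).PosSemidef
  hankel_x : ∀ i j, i < j →
    (hankelH D.m (fun k => v.2.1 k i j) (D.a i j : EReal) (D.b i j : EReal)).PosSemidef
  hankel_diag : ∀ i,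
    (hankelH D.m (fun k => v.2.1 k i i - v.1 i * D.F 0 ^ (k : ℕ))
      (D.a i i : EReal) (D.b i i : EReal)).PosSemidef
  ad : (D.Ad v).PosSemidef
  y_zero : ∀ i j, v.2.2 D.zeroIdx i j = v.1 j
  c_nonneg : ∀ j, 0 ≤ v.1 j
  bordered : (borderedMatrix v.1 (v.2.1 D.zeroIdx)).PosSemidef

/-- `c^*`, the maximal value of `c = c_1 + … + c_d` subject to the constraints, as a supremum in the
extended real numbers. -/
noncomputable def cStar [MetricSpace M] (D : Program M r d) : EReal :=
  ⨆ (v : Vars D.m r d) (_ : D.Feasible v), ((∑ j, v.1 j : ℝ) : EReal)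

end Program

end CodeSDP

/-!
For each `k < K` the kernel `Φ_k(τ(x, y))` is a multiple of the Gram matrix of a family of functions
in `L²(μ)`, and the normalization `Φ_k(τ_0) = 1` makes the multiple nonnegative, so the kernel is
positive semidefinite. For a code `C`, the matrix `Γ_k` at the moments of `C` is obtained from this
kernel by summing over the blocks `{q_i}` and `C ∩ Π_j`, hence `Γ_k ⪰ 0`. The Hankel conditions hold
because the moments of finitely many points of `[a, b]` are nonnegative combinations of the rank one
matrices `(t^{i+j})`, and the bordered matrix is of rank one. So every code gives a feasible point
whose objective value is at least `|C|`.
-/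

namespace CodeSDP

open Matrix

section PosSemidef

variable {m n R : Type*}

theorem posSemidef_fromBlocks_diagonal [Ring R] [PartialOrder R] [StarRing R] [AddLeftMono R]
    [Finite m] [Finite n] {A : Matrix m m R} {B : Matrix n n R}
    (hA : A.PosSemidef) (hB : B.PosSemidef) : (fromBlocks A 0 0 B).PosSemidef := by
  have := Fintype.ofFinite m
  have := Fintype.ofFinite n
  refine .of_dotProduct_mulVec_nonneg (hA.1.fromBlocks (by simp) hB.1) fun x => ?_
  simpa [fromBlocks_mulVec, dotProduct_block] using!
    add_nonneg (hA.dotProduct_mulVec_nonneg (x ∘ Sum.inl))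
      (hB.dotProduct_mulVec_nonneg (x ∘ Sum.inr))

-- `Matrix.posSemidef_gram` is for finite index types; the kernel is indexed by all of `M`.
open scoped ComplexOrder in
theorem posSemidef_gram {𝕜 E : Type*} [RCLike 𝕜] [SeminormedAddCommGroup E]
    [InnerProductSpace 𝕜 E] (v : n → E) : (gram 𝕜 v).PosSemidef := by
  refine ⟨isHermitian_gram 𝕜 v, fun x => ?_⟩
  calc (0 : 𝕜)
      ≤ ((‖x.sum fun i c => c • v i‖ ^ 2 : ℝ) : 𝕜) := RCLike.ofReal_nonneg.2 (sq_nonneg _)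
    _ = inner 𝕜 (x.sum fun i c => c • v i) (x.sum fun i c => c • v i) := by
        rw [inner_self_eq_norm_sq_to_K, RCLike.ofReal_pow]
    _ = x.sum fun i xi => x.sum fun j xj => star xi * gram 𝕜 v i j * xj := by
        simp only [Finsupp.sum, sum_inner, inner_sum, gram_apply, RCLike.star_def,
          inner_smul_left, inner_smul_right, Finset.mul_sum]
        rw [Finset.sum_comm]
        congr! 2
        ring

theorem posSemidef_blockSum [Ring R] [PartialOrder R] [StarRing R] {A : Matrix m m R}
    (hA : A.PosSemidef) (T : n → Finset m) :
    (of fun i j => ∑ u ∈ T i, ∑ v ∈ T j, A u v).PosSemidef := by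
  refine ⟨IsHermitian.ext fun i j => ?_, fun x => ?_⟩
  · simp only [of_apply, star_sum, hA.1.apply]
    exact Finset.sum_comm
  · -- The form at `x` is the form of `A` at `∑ i, x i • 1_{T i}`.
    have hsum (f : m → R → R) (h0 : ∀ u, f u 0 = 0)
        (hadd : ∀ u a b, f u (a + b) = f u a + f u b) :
        (x.sum fun i c => ∑ u ∈ T i, Finsupp.single u c).sum f =
          x.sum fun i c => ∑ u ∈ T i, f u c := by
      rw [Finsupp.sum_sum_index h0 hadd]
      simp [← Finsupp.sum_finsetSum_index h0 hadd, h0]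
    convert hA.2 (x.sum fun i c => ∑ u ∈ T i, Finsupp.single u c) using 1
    rw [hsum _ (by simp) (by simp [add_mul, Finsupp.sum_add])]
    refine Finsupp.sum_congr fun i _ => ?_
    simp_rw [hsum _ (fun _ => mul_zero _) (fun _ _ _ => mul_add _ _ _), of_apply,
      Finset.mul_sum, Finset.sum_mul]
    rw [Finsupp.sum_finsetSum_comm]

end PosSemidef

section Hankel

variable {ι : Type*} (s : Finset ι) {t : ι → ℝ}

theorem posSemidef_sum_mul_pow {w : ι → ℝ} (hw : ∀ p ∈ s, 0 ≤ w p) (t : ι → ℝ) (m : ℕ) :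
    (of fun i j : Fin m => ∑ p ∈ s, w p * t p ^ (i + j : ℕ)).PosSemidef := by
  convert posSemidef_sum s fun p hp =>
    (posSemidef_vecMulVec_self_star fun i : Fin m => t p ^ (i : ℕ)).smul (hw p hp) using 1
  ext i j
  simp [Matrix.sum_apply, vecMulVec_apply, pow_add]

theorem posSemidef_hankelR (t : ι → ℝ) (m : ℕ) :
    (hankelR m fun k => ∑ p ∈ s, t p ^ (k : ℕ)).PosSemidef := by
  simpa [hankelR] using posSemidef_sum_mul_pow s (w := 1) (by simp) t m

theorem posSemidef_hankelPlus {a : EReal} (ha : ∀ p ∈ s, a ≤ t p) (m : ℕ) :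
    (hankelPlus m (fun k => ∑ p ∈ s, t p ^ (k : ℕ)) a).PosSemidef := by
  unfold hankelPlus
  split_ifs with hinf
  · exact .zero
  lift a to ℝ using by tauto
  convert posSemidef_sum_mul_pow s (w := fun p => t p - a)
    (fun p hp => sub_nonneg.2 (EReal.coe_le_coe_iff.1 (ha p hp))) t m using 4
  simp [Finset.mul_sum, sub_mul, pow_succ']

theorem posSemidef_hankelMinus {b : EReal} (hb : ∀ p ∈ s, t p ≤ b) (m : ℕ) :
    (hankelMinus m (fun k => ∑ p ∈ s, t p ^ (k : ℕ)) b).PosSemidef := by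
  unfold hankelMinus
  split_ifs with hinf
  · exact .zero
  lift b to ℝ using by tauto
  convert posSemidef_sum_mul_pow s (w := fun p => b - t p)
    (fun p hp => sub_nonneg.2 (EReal.coe_le_coe_iff.1 (hb p hp))) t m using 4
  simp [Finset.mul_sum, sub_mul, pow_succ']

theorem posSemidef_hankelH {a b : EReal} (ht : ∀ p ∈ s, (t p : EReal) ∈ Set.Icc a b) (m : ℕ) :
    (hankelH m (fun k => ∑ p ∈ s, t p ^ (k : ℕ)) a b).PosSemidef :=
  posSemidef_fromBlocks_diagonal (posSemidef_hankelR s t m) <|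
    posSemidef_fromBlocks_diagonal (posSemidef_hankelPlus s (fun p hp => (ht p hp).1) m)
      (posSemidef_hankelMinus s (fun p hp => (ht p hp).2) m)

end Hankel

theorem posSemidef_borderedMatrix {d : ℕ} (c : Fin d → ℝ) :
    (borderedMatrix c fun i j => c i * c j).PosSemidef := by
  convert posSemidef_vecMulVec_self_star (Sum.elim (fun _ : Unit => (1 : ℝ)) c) using 1
  ext (i | i) (j | j) <;> simp [borderedMatrix, vecMulVec_apply]

section CodePart

variable {M ι : Type*}

open Classical in
/-- The part `C_j = C ∩ Π_j` of a finite set `C`. -/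
noncomputable def codePart (Q : ι → Set M) (C : Finset M) (j : ι) : Finset M :=
  C.filter fun v => v ∈ Q j

theorem mem_codePart {Q : ι → Set M} {C : Finset M} {j : ι} {v : M} :
    v ∈ codePart Q C j ↔ v ∈ C ∧ v ∈ Q j := by
  simp [codePart]

theorem card_le_sum_card_codePart [Fintype ι] {Q : ι → Set M} {C : Finset M}
    (hcover : (C : Set M) ⊆ ⋃ j, Q j) : C.card ≤ ∑ j, (codePart Q C j).card := by
  classical
  refine (Finset.card_le_card fun v hv => ?_).trans Finset.card_biUnion_le
  simpa [mem_codePart, Finset.mem_coe.1 hv] using hcover hv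

end CodePart

variable {M : Type*} [MetricSpace M] {F : ℝ → ℝ}

theorem tau_comm (F : ℝ → ℝ) (x y : M) : tau F x y = tau F y x := by
  rw [tau, tau, dist_comm]

theorem tau_self (F : ℝ → ℝ) (x : M) : tau F x x = F 0 := by
  rw [tau, dist_self]

/-- The matrix, indexed by the points of `M`, of the kernel `(x, y) ↦ φ(τ(x, y))`. -/
noncomputable def zonalKernel (M : Type*) [MetricSpace M] (F : ℝ → ℝ) (φ : ℝ[X]) : Matrix M M ℝ :=
  of fun x y => φ.eval (tau F x y)

theorem IsZonalSpherical.posSemidef_zonalKernel [CompactSpace M] [MeasurableSpace M] [BorelSpace M]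
    {μ : Measure M} [IsFiniteMeasure μ] {V : Submodule ℝ C(M, ℝ)} {φ : ℝ[X]}
    (h : IsZonalSpherical μ F V φ) : (zonalKernel M F φ).PosSemidef := by
  choose z hzV hz using h.mem
  obtain ⟨κ, hκ⟩ := h.reproducing
  have hgram : zonalKernel M F φ = κ • gram ℝ fun x => ContinuousMap.toLp 2 μ ℝ (z x) := by
    ext x y
    calc φ.eval (tau F x y)
        = z x y := by rw [hz, tau_comm]
      _ = κ * ∫ w, z x w * φ.eval (tau F w y) ∂μ := hκ _ (hzV x) y
      _ = κ * inner ℝ (ContinuousMap.toLp 2 μ ℝ (z x)) (ContinuousMap.toLp 2 μ ℝ (z y)) := by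
        simp [ContinuousMap.inner_toLp, hz, mul_comm]
  have hpsd := posSemidef_gram (𝕜 := ℝ) fun x => ContinuousMap.toLp 2 μ ℝ (z x)
  cases isEmpty_or_nonempty M with
  | inl _ => simpa [Subsingleton.elim (zonalKernel M F φ) 0] using PosSemidef.zero
  | inr hne =>
    obtain ⟨y⟩ := hne
    have hκ_pos : 0 < κ := by
      have hdiag : κ * gram ℝ (fun x => ContinuousMap.toLp 2 μ ℝ (z x)) y y = 1 := by
        rw [← smul_eq_mul, ← Matrix.smul_apply, ← hgram]
        simp [zonalKernel, tau_self, h.normalized]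
      exact pos_of_mul_pos_left (hdiag ▸ one_pos) hpsd.diag_nonneg
    exact hgram ▸ hpsd.smul hκ_pos.le

theorem IsZonalFamily.natDegree_eq_and_posSemidef_zonalKernel {G : Type*} [Group G] [MulAction G M]
    [CompactSpace M] [MeasurableSpace M] [BorelSpace M] {μ : Measure M} [IsFiniteMeasure μ]
    {K : ℕ∞} {Φ : ℕ → ℝ[X]} (h : IsZonalFamily G μ F K Φ) {k : ℕ} (hk : (k : ℕ∞) < K) :
    (Φ k).natDegree = k ∧ (zonalKernel M F (Φ k)).PosSemidef := by
  obtain ⟨V, -, -, -, hzonal, hdeg⟩ := h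
  exact ⟨hdeg k hk, (hzonal k hk).posSemidef_zonalKernel⟩

section Code

variable {r d m : ℕ} (Q : Fin d → Set M) (C : Finset M)

theorem codeVars_eq (F : ℝ → ℝ) (m : ℕ) (q : Fin r → M) : codeVars F m q Q C =
    (fun j => ((codePart Q C j).card : ℝ),
     fun (k : Fin (2 * m)) i j => ∑ p ∈ codePart Q C i ×ˢ codePart Q C j, tau F p.1 p.2 ^ (k : ℕ),
     fun (k : Fin (2 * m)) i j => ∑ v ∈ codePart Q C j, tau F (q i) v ^ (k : ℕ)) := by
  simp only [Finset.sum_product]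
  rfl

theorem sum_coeff_mul_sum_pow {R ι : Type*} [CommSemiring R] {φ : R[X]} {N : ℕ}
    (hφ : φ.natDegree < N) (s : Finset ι) (t : ι → R) :
    ∑ l : Fin N, φ.coeff l * ∑ p ∈ s, t p ^ (l : ℕ) = ∑ p ∈ s, φ.eval (t p) := by
  simp_rw [Finset.mul_sum]
  rw [Finset.sum_comm]
  simp_rw [eval_eq_sum_range' hφ, Finset.sum_range]

theorem gammaMatrix_codeVars (F : ℝ → ℝ) {φ : ℝ[X]} (hφ : φ.natDegree < 2 * m) (q : Fin r → M) :
    gammaMatrix F φ q (codeVars F m q Q C) =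
      let T : Fin r ⊕ Fin d → Finset M := Sum.elim (fun i => {q i}) (codePart Q C)
      of fun i j => ∑ u ∈ T i, ∑ v ∈ T j, zonalKernel M F φ u v := by
  ext (i | i) (j | j) <;>
    simp [gammaMatrix, codeVars_eq, zonalKernel, sum_coeff_mul_sum_pow hφ, ← Finset.sum_product']
  simp only [tau_comm F]

theorem posSemidef_gammaMatrix_codeVars {φ : ℝ[X]} (hφ : φ.natDegree < 2 * m)
    (hker : (zonalKernel M F φ).PosSemidef) (q : Fin r → M) :
    (gammaMatrix F φ q (codeVars F m q Q C)).PosSemidef :=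
  gammaMatrix_codeVars Q C F hφ q ▸ posSemidef_blockSum hker _

theorem sum_product_tau_pow_sub (F : ℝ → ℝ) (s : Finset M) (k : ℕ) :
    ∑ p ∈ s ×ˢ s, tau F p.1 p.2 ^ k - s.card * F 0 ^ k = ∑ p ∈ s.offDiag, tau F p.1 p.2 ^ k := by
  classical
  rw [← Finset.diag_union_offDiag, Finset.sum_union s.disjoint_diag_offDiag, Finset.sum_diag]
  simp [tau_self]

end Code

namespace Program

variable {r d : ℕ}

theorem feasible_codeVars (D : Program M r d)
    (hΦ : ∀ k : Fin (2 * D.m), ((k : ℕ) : ℕ∞) < D.K →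
      (D.Φ k).natDegree < 2 * D.m ∧ (zonalKernel M D.F (D.Φ k)).PosSemidef)
    {Q : Fin d → Set M} (hdisj : Pairwise fun i j => Disjoint (Q i) (Q j))
    (hq : ∀ j, ∀ v ∈ Q j, ∀ i, (tau D.F (D.q i) v : EReal) ∈ Set.Icc (D.α i j) (D.β i j))
    {C : Finset M}
    (hab : ∀ i j, i ≤ j → ∀ u ∈ codePart Q C i, ∀ v ∈ codePart Q C j, u ≠ v →
      tau D.F u v ∈ Set.Icc (D.a i j) (D.b i j))
    (hAd : (D.Ad (codeVars D.F D.m D.q Q C)).PosSemidef) :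
    D.Feasible (codeVars D.F D.m D.q Q C) where
  x_symm k i j := by
    simp only [codeVars_eq, Finset.sum_product]
    rw [Finset.sum_comm]
    simp only [tau_comm D.F]
  gamma k hk := posSemidef_gammaMatrix_codeVars Q C (hΦ k hk).1 (hΦ k hk).2 D.q
  hankel_y i j := posSemidef_hankelH _ (fun v hv => hq j v (mem_codePart.1 hv).2 i) D.m
  hankel_x i j hij := by
    simp only [codeVars_eq]
    refine posSemidef_hankelH _ (fun p hp => ?_) D.m
    obtain ⟨hu, hv⟩ := Finset.mem_product.1 hp
    have hne : p.1 ≠ p.2 :=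
      (hdisj hij.ne).ne_of_mem (mem_codePart.1 hu).2 (mem_codePart.1 hv).2
    simpa using hab i j hij.le p.1 hu p.2 hv hne
  hankel_diag i := by
    simp only [codeVars_eq, sum_product_tau_pow_sub]
    refine posSemidef_hankelH _ (fun p hp => ?_) D.m
    obtain ⟨hu, hv, hne⟩ := Finset.mem_offDiag.1 hp
    simpa using hab i i le_rfl p.1 hu p.2 hv hne
  ad := hAd
  y_zero i j := by simp [codeVars_eq, zeroIdx]
  c_nonneg j := by simp [codeVars_eq]
  bordered := by
    simpa [codeVars_eq, zeroIdx] using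
      posSemidef_borderedMatrix fun j => ((codePart Q C j).card : ℝ)

theorem Feasible.sum_le_cStar {D : Program M r d} {v : Vars D.m r d} (hv : D.Feasible v) :
    ((∑ j, v.1 j : ℝ) : EReal) ≤ D.cStar :=
  le_iSup₂ (f := fun (v : Vars D.m r d) (_ : D.Feasible v) => ((∑ j, v.1 j : ℝ) : EReal)) v hv

end Program

theorem maxCode_le {S : Set ℝ} {P : Set M} {B : EReal}
    (h : ∀ C : Finset M, (C : Set M) ⊆ P → IsCode F S C → ((C.card : ℝ) : EReal) ≤ B) :
    ((maxCode F S P : ℝ≥0∞) : EReal) ≤ B := by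
  have hB : 0 ≤ B := by simpa using h ∅ (by simp) (by simp [IsCode])
  rw [← EReal.coe_toENNReal hB, EReal.coe_ennreal_le_coe_ennreal_iff, maxCode]
  simp only [ENat.toENNReal_iSup, iSup_le_iff]
  rintro C ⟨hCP, hC⟩
  rw [← EReal.coe_ennreal_le_coe_ennreal_iff, EReal.coe_toENNReal hB]
  exact_mod_cast h C hCP hC

end CodeSDP

theorem theorem7p3_general {M : Type*} [MetricSpace M] {r d : ℕ} (D : CodeSDP.Program M r d)
    (hΦ : ∀ k : Fin (2 * D.m), ((k : ℕ) : ℕ∞) < D.K →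
      (D.Φ k).natDegree < 2 * D.m ∧ (CodeSDP.zonalKernel M D.F (D.Φ k)).PosSemidef)
    (S : Set ℝ) (P : Set M) (Q : Fin d → Set M)
    (hcover : P ⊆ ⋃ j, Q j)
    (hdisj : ∀ i j, i ≠ j → Disjoint (Q i) (Q j))
    (hq : ∀ j, ∀ v ∈ Q j, ∀ i,
      D.α i j ≤ (CodeSDP.tau D.F (D.q i) v : EReal) ∧
      (CodeSDP.tau D.F (D.q i) v : EReal) ≤ D.β i j)
    (hab : ∀ i j, i ≤ j → ∀ u ∈ Q i, ∀ v ∈ Q j, u ≠ v →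
      CodeSDP.tau D.F u v ∈ S → CodeSDP.tau D.F u v ∈ Set.Icc (D.a i j) (D.b i j))
    (hAd : ∀ C : Finset M, (C : Set M) ⊆ P → CodeSDP.IsCode D.F S C →
      (D.Ad (CodeSDP.codeVars D.F D.m D.q Q C)).PosSemidef) :
    ((CodeSDP.maxCode D.F S P : ℝ≥0∞) : EReal) ≤ D.cStar := by
  refine CodeSDP.maxCode_le fun C hCP hC => ?_
  have hfeas : D.Feasible (CodeSDP.codeVars D.F D.m D.q Q C) := by
    refine D.feasible_codeVars hΦ (fun i j => hdisj i j) hq (fun i j hij u hu v hv hne => ?_)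
      (hAd C hCP hC)
    obtain ⟨huC, huQ⟩ := CodeSDP.mem_codePart.1 hu
    obtain ⟨hvC, hvQ⟩ := CodeSDP.mem_codePart.1 hv
    exact hab i j hij u huQ v hvQ hne (hC u huC v hvC hne)
  calc ((C.card : ℝ) : EReal)
      ≤ ((∑ j, ((CodeSDP.codePart Q C j).card : ℝ) : ℝ) : EReal) := by
        exact_mod_cast CodeSDP.card_le_sum_card_codePart (hCP.trans hcover)
    _ ≤ D.cStar := hfeas.sum_le_cStar

theorem theorem7p3 {G M : Type*} [Group G] [MetricSpace M] [CompactSpace M] [MulAction G M]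
    [MeasurableSpace M] [BorelSpace M]
    (hM : CodeSDP.IsTwoPointHomogeneous G M)
    (μ : Measure M) [IsProbabilityMeasure μ] [SMulInvariantMeasure G M μ]
    {r d : ℕ} (D : CodeSDP.Program M r d)
    (hΦ : CodeSDP.IsZonalFamily G μ D.F D.K D.Φ)
    (a b : ℝ) (S : Set ℝ) (hS : S = CodeSDP.tauValues M D.F ∩ Set.Icc a b)
    (P : Set M) (Q : Fin d → Set M)
    (hcover : P ⊆ ⋃ j, Q j)
    (hdisj : ∀ i j, i ≠ j → Disjoint (Q i) (Q j))
    (hq : ∀ j, ∀ v ∈ Q j, ∀ i,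
      D.α i j ≤ (CodeSDP.tau D.F (D.q i) v : EReal) ∧
      (CodeSDP.tau D.F (D.q i) v : EReal) ≤ D.β i j)
    (hab : ∀ i j, i ≤ j → ∀ u ∈ Q i, ∀ v ∈ Q j, u ≠ v →
      CodeSDP.tau D.F u v ∈ Set.Icc a b → CodeSDP.tau D.F u v ∈ Set.Icc (D.a i j) (D.b i j))
    (hAd : ∀ C : Finset M, (C : Set M) ⊆ P → CodeSDP.IsCode D.F S C →
      (D.Ad (CodeSDP.codeVars D.F D.m D.q Q C)).PosSemidef) :
    ((CodeSDP.maxCode D.F S P : ℝ≥0∞) : EReal) ≤ D.cStar := by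
  subst hS
  exact theorem7p3_general D
    (fun k hk => (hΦ.natDegree_eq_and_posSemidef_zonalKernel hk).imp_left (·.trans_lt k.2))
    _ P Q hcover hdisj hq (fun i j hij u hu v hv hne h => hab i j hij u hu v hv hne h.2) hAd
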